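/- Let $r\ge 0$ and $s\ge 2$ be integers, and let $W=\langle e_1,\dots,e_r,f_1,\dots,f_s\rangle$ be the complex $\mathbb{Z}_2$-graded vector space of dimension $r|s$ with even basis vectors $e_i$ and odd basis vectors $f_j$. For a multi-index $I=(i_1,\dots,i_n)$ of basis vectors, $n\ge 0$, and a basis vector $i$, let $\varphi^I_i\colon T^n(W)\to W$ be the linear map with $\varphi^I_i(j_1\otimes\cdots\otimes j_n)=i$ if $(j_1,\dots,j_n)=I$ and $0$ for every other multi-index; it has parity $|I|+|i|$, where $|I|=|i_1|+\dots+|i_n|$, and is written $\psi^I_i$ when it is odd. Let $C^n(W)=\operatorname{Hom}(T^n(W),W)$ and $C(W)=\operatorname{Hom}(T(W),W)=\prod_{n\ge0}C^n(W)$, which is identified with the space of coderivations of the tensor coalgebra $T(W)$. Composition is given by $$\varphi^I_i\circ\varphi^J_j=\sum_{k=1}^{\ell(I)}(-1)^{(|i_1|+\cdots+|i_{k-1}|)(|J|+|j|)}\,\delta^{i_k}_j\,\varphi^{(I,J,k)}_i ,$$ where $(I,J,k)$ is $I$ with its $k$-th entry replaced by the string $J$, and the graded bracket by $[\varphi,\psi]=\varphi\circ\psi-(-1)^{|\varphi||\psi|}\psi\circ\varphi$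 for homogeneous $\varphi,\psi$. An odd element $d$ of $C(W)$ with $[d,d]=0$ is called a codifferential; for a codifferential $d\in C^2(W)$ put $D(\varphi)=[d,\varphi]$ and $$H^n=\ker\bigl(D\colon C^n(W)\to C^{n+1}(W)\bigr)\big/D\bigl(C^{n-1}(W)\bigr),\qquad C^{-1}(W)=0 .$$ Then $d=\psi^{f_1f_1}_{f_s}$ is a codifferential, and its cohomology satisfies $$h^n=\dim_{\mathbb C}H^n=(r+s-1)^{n+1}+1\qquad\text{for all } n\ge 0 .$$ -/

import Mathlib

namespace NilpotentCohomology

noncomputable section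

/-- The index set of the homogeneous basis `e_1, …, e_r, f_1, …, f_s`: the left summand indexes
the `e_i`, the right summand indexes the `f_j`. -/
abbrev Idx (r s : ℕ) : Type := Fin r ⊕ Fin s

/-- The `r|s`-dimensional complex vector space `W = ⟨e_i, f_j⟩`. -/
def W (r s : ℕ) : Type := Idx r s → ℂ

instance (r s : ℕ) : AddCommGroup (W r s) := inferInstanceAs (AddCommGroup (Idx r s → ℂ))

instance (r s : ℕ) : Module ℂ (W r s) := inferInstanceAs (Module ℂ (Idx r s → ℂ))

/-- The basis `e_1, …, e_r, f_1, …, f_s` of `W`. -/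
def basisW (r s : ℕ) : Module.Basis (Idx r s) ℂ (W r s) := Pi.basisFun ℂ (Idx r s)

/-- The parity of a basis vector: `e_i` is even, `f_j` is odd. -/
def par {r s : ℕ} : Idx r s → ℕ := Sum.elim (fun _ => 0) (fun _ => 1)

/-- The parity `|I| = |i_1| + ⋯ + |i_n|` of a multi-index (to be read modulo 2). -/
def wordPar {r s : ℕ} (I : List (Idx r s)) : ℕ := (I.map par).sum

/-- The underlying vector space of the tensor coalgebra `T(W) = ⨁ₙ W^{⊗ n}`, `n ≥ 0`. -/
abbrev T (r s : ℕ) : Type := TensorAlgebra ℂ (W r s)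

/-- The basis of `T(W)` formed by the tensors `i_1 ⊗ ⋯ ⊗ i_n`, one for each multi-index. -/
def wordBasis (r s : ℕ) : Module.Basis (List (Idx r s)) ℂ (T r s) :=
  (basisW r s).tensorAlgebra.reindex FreeMonoid.toList

/-- The tensor `i_1 ⊗ ⋯ ⊗ i_n` in `T(W)` of a multi-index `I = (i_1, …, i_n)`. -/
def word {r s : ℕ} (I : List (Idx r s)) : T r s :=
  (I.map fun i => TensorAlgebra.ι ℂ (basisW r s i)).prod

theorem wordBasis_apply {r s : ℕ} (I : List (Idx r s)) : wordBasis r s I = word I := by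
  have h : ∀ J : FreeMonoid (Idx r s), (basisW r s).tensorAlgebra J =
      FreeMonoid.lift (fun i => TensorAlgebra.ι ℂ (basisW r s i)) J := by
    intro J
    have h1 : FreeAlgebra.basisFreeMonoid ℂ (Idx r s) J =
        FreeMonoid.lift (FreeAlgebra.ι ℂ) J := by
      simp [FreeAlgebra.basisFreeMonoid, FreeAlgebra.equivMonoidAlgebraFreeMonoid]
    rw [Module.Basis.tensorAlgebra, Module.Basis.map_apply, h1]
    simp [FreeMonoid.lift_apply, map_list_prod, Function.comp_def]
  rw [wordBasis, Module.Basis.reindex_apply, h, FreeMonoid.lift_apply]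
  rfl

/-- The space of cochains `C(W) = Hom(T(W), W)`. -/
abbrev Cochain (r s : ℕ) : Type := T r s →ₗ[ℂ] W r s

/-- The basic cochain `φ^I_i`, with `φ^I_i (J) = δ^I_J i`. -/
def basicCochain {r s : ℕ} (I : List (Idx r s)) (i : Idx r s) : Cochain r s :=
  (wordBasis r s).constr ℂ fun J => if I = J then basisW r s i else 0

/-- The space `C^n(W)` of `n`-cochains: the cochains vanishing on `W^{⊗ m}` for `m ≠ n`. -/
def cochains (r s n : ℕ) : Submodule ℂ (Cochain r s) where
  carrier := {φ | ∀ J : List (Idx r s), J.length ≠ n → φ (word J) = 0}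
  add_mem' := fun {φ ψ} hφ hψ J hJ => by
    rw [LinearMap.add_apply, hφ J hJ, hψ J hJ, add_zero]
  zero_mem' := fun _ _ => rfl
  smul_mem' := fun c φ hφ J hJ => by rw [LinearMap.smul_apply, hφ J hJ, smul_zero]

/-- The even (`p = 0`) and odd (`p = 1`) parts of a cochain; the basic cochain `φ^I_i` has
parity `|I| + |i|`. -/
def parityPart {r s : ℕ} (p : ℕ) : Cochain r s →ₗ[ℂ] Cochain r s where
  toFun φ := (wordBasis r s).constr ℂ fun J =>
    ∑ j : Idx r s, if (wordPar J + par j) % 2 = p then (basisW r s).repr (φ (word J)) j • basisW r s j else 0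
  map_add' φ ψ := by
    refine (wordBasis r s).ext fun J => ?_
    simp only [LinearMap.add_apply, Module.Basis.constr_basis, ← Finset.sum_add_distrib]
    refine Finset.sum_congr rfl fun j _ => ?_
    split_ifs <;> simp [add_smul]
  map_smul' c φ := by
    refine (wordBasis r s).ext fun J => ?_
    simp only [LinearMap.smul_apply, Module.Basis.constr_basis, Finset.smul_sum, RingHom.id_apply]
    refine Finset.sum_congr rfl fun j _ => ?_
    split_ifs <;> simp [mul_smul]

/-- A cochain is odd if it is its own odd part. -/
def IsOdd {r s : ℕ} (φ : Cochain r s) : Prop := parityPart 1 φ = φ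

/-- The coderivation of `T(W)` determined by a cochain `ψ`. On a tensor `x` it is the sum, over
all ways of writing `x = u ⊗ v ⊗ t`, of `(-1)^{|u||ψ|} u ⊗ ψ(v) ⊗ t`; the component of `ψ` taking
`v` to the basis vector `j` has parity `|v| + |j|`. -/
def coderivation {r s : ℕ} : Cochain r s →ₗ[ℂ] Module.End ℂ (T r s) where
  toFun ψ := (wordBasis r s).constr ℂ fun x =>
    ∑ k ∈ Finset.range (x.length + 1), ∑ m ∈ Finset.range (x.length - k + 1),
      let u := x.take k
      let v := (x.drop k).take m
      let t := (x.drop k).drop m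
      ∑ j : Idx r s,
        ((-1 : ℂ) ^ (wordPar u * (wordPar v + par j)) * (basisW r s).repr (ψ (word v)) j) • word (u ++ j :: t)
  map_add' φ ψ := by
    refine (wordBasis r s).ext fun x => ?_
    simp only [LinearMap.add_apply, Module.Basis.constr_basis, ← Finset.sum_add_distrib,
      map_add, Finsupp.add_apply, mul_add, add_smul]
  map_smul' c φ := by
    refine (wordBasis r s).ext fun x => ?_
    simp only [LinearMap.smul_apply, Module.Basis.constr_basis, Finset.smul_sum,
      RingHom.id_apply, map_smul, Finsupp.smul_apply, smul_eq_mul, smul_smul, mul_left_comm]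

/-- The composition `φ ∘ ψ` of cochains: `φ` after the coderivation determined by `ψ`. -/
def comp {r s : ℕ} : Cochain r s →ₗ[ℂ] Cochain r s →ₗ[ℂ] Cochain r s :=
  (LinearMap.llcomp ℂ (T r s) (T r s) (W r s)).compl₂ coderivation

/-- The graded bracket of `C(W)`: the bilinear map with
`[φ, ψ] = φ ∘ ψ - (-1)^{|φ||ψ|} ψ ∘ φ` for homogeneous `φ` and `ψ`. -/
def bracket {r s : ℕ} : Cochain r s →ₗ[ℂ] Cochain r s →ₗ[ℂ] Cochain r s :=
  ∑ p ∈ Finset.range 2, ∑ q ∈ Finset.range 2,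
    LinearMap.compl₁₂ (comp - (-1 : ℂ) ^ (p * q) • LinearMap.flip comp)
      (parityPart (r := r) (s := s) p) (parityPart (r := r) (s := s) q)

/-- A codifferential is an odd cochain (that is, an odd coderivation of `T(W)`) with
`[d, d] = 0`. -/
def IsCodifferential {r s : ℕ} (d : Cochain r s) : Prop := IsOdd d ∧ bracket d d = 0

/-- The coboundary operator `D(φ) = [d, φ]`. -/
def coboundary {r s : ℕ} (d : Cochain r s) : Cochain r s →ₗ[ℂ] Cochain r s := bracket d

/-- The `n`-cocycles of `D`: the kernel of `D` on `C^n(W)`. -/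
def cocycles {r s : ℕ} (d : Cochain r s) (n : ℕ) : Submodule ℂ (Cochain r s) :=
  cochains r s n ⊓ LinearMap.ker (coboundary d)

/-- The `n`-coboundaries of `D`: the image of `C^{n-1}(W)` under `D` (zero for `n = 0`). -/
def coboundaries {r s : ℕ} (d : Cochain r s) : ℕ → Submodule ℂ (Cochain r s)
  | 0 => ⊥
  | n + 1 => (cochains r s n).map (coboundary d)

/-- The cohomology `H^n` of a quadratic codifferential `d`. -/
abbrev Cohomology {r s : ℕ} (d : Cochain r s) (n : ℕ) : Type :=
  cocycles d n ⧸ (coboundaries d n).submoduleOf (cocycles d n)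

/-- The cochain `d = ψ^{f_1 f_1}_{f_s}`. -/
def dNil (r s : ℕ) (hs : 2 ≤ s) : Cochain r s :=
  basicCochain [Sum.inr ⟨0, by omega⟩, Sum.inr ⟨0, by omega⟩] (Sum.inr ⟨s - 1, by omega⟩)

end

end NilpotentCohomology

namespace NilpotentCohomology

/-! Write `a = f_1`, `b = f_s`, and read the coefficients of a cochain at each output letter as a
function on words. Composing with `d` on the right acts on every coordinate by `del`, the odd
derivation `b ↦ aa`. Composing with `d` on the left sends the `a`-coordinate to the `b`-coordinate
by multiplying with `a` on either side, which up to sign is `adA = L - R`. After a twist by word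
signs, the complex therefore splits into one copy of the `del`-complex for each of the `N = r + s -
2` letters other than `a` and `b`, and one mapping cone of `adA` for the pair of coordinates at `a`
and `b` (`coord_coboundary_dNil`, `cocyclesEquiv`).

Dimensions are found by peeling off leading letters. Solving the cycle equation on the first two
letters expresses cycles of length `n + 2` through free functions and shorter cycles (`cycEquiv`),
and similarly for the cone (`pairCycEquiv`). If `z_n` and `p_n` are the dimensions of the two cycle
spaces, this yields `z_{n+1} + z_n = (N+1)^{n+1} + (N+2)^n` and `p_{n+1} + p_n = 2(N+2)^n +
(N+1)^{n+1} + 1`. Rank-nullity on cochains, where `dim C^n = (N+2)^{n+1}`, then gives `h^{n+1} =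
N(z_{n+1} + z_n) + (p_{n+1} + p_n) - (N+2)^{n+1} = (N+1)^{n+2} + 1`; degree zero is checked
directly. -/

/-- Signs on an alphabet together with two distinct odd letters `a` and `b`. -/
structure LetterData (ι : Type*) where
  sgn : ι → ℂ
  a : ι
  b : ι
  sgn_mul_self : ∀ i, sgn i * sgn i = 1
  sgn_a : sgn a = -1
  sgn_b : sgn b = -1
  a_ne_b : a ≠ b

/-! ### Functions on words and their leading-letter slices -/

/-- Functions on words. -/
abbrev WordFun (ι : Type*) : Type _ := List ι → ℂ

namespace WordFun

variable {ι : Type*}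

/-- The coefficient of the leading letter `i`. -/
def slice (i : ι) : WordFun ι →ₗ[ℂ] WordFun ι where
  toFun u J := u (i :: J)
  map_add' _ _ := rfl
  map_smul' _ _ := rfl

theorem slice_apply (i : ι) (u : WordFun ι) (J : List ι) : slice i u J = u (i :: J) := rfl

theorem ext_slice {u v : WordFun ι} (h0 : u [] = v []) (h : ∀ i, slice i u = slice i v) :
    u = v := by
  funext J
  cases J with
  | nil => exact h0
  | cons i J => exact congrFun (h i) J

/-- Induction on the word with `u` left general: the operators below are recursive in the leading
letter, so a claim at `i :: J` reduces to the claim at `J` for other functions. -/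
theorem eq_of_slice {F G : WordFun ι →ₗ[ℂ] WordFun ι} (h0 : ∀ u, F u [] = G u [])
    (h : ∀ J, (∀ u, F u J = G u J) → ∀ i u, slice i (F u) J = slice i (G u) J) : F = G := by
  ext1 u
  funext J
  induction J generalizing u with
  | nil => exact h0 u
  | cons i J ih => exact h J ih i u

/-- The function with prescribed slices that vanishes on the empty word. -/
def assemble (f : ι → WordFun ι) : WordFun ι
  | [] => 0
  | i :: J => f i J

@[simp] theorem assemble_nil (f : ι → WordFun ι) : assemble f [] = 0 := rfl

@[simp] theorem slice_assemble (f : ι → WordFun ι) (i : ι) : slice i (assemble f) = f i := rfl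

/-- The indicator of the empty word. -/
def one : WordFun ι
  | [] => 1
  | _ :: _ => 0

@[simp] theorem one_nil : (one : WordFun ι) [] = 1 := rfl

@[simp] theorem slice_one (i : ι) : slice i one = 0 := rfl

/-- The functions supported on words of length `n`. -/
def degree (ι : Type*) (n : ℕ) : Submodule ℂ (WordFun ι) where
  carrier := {u | ∀ J, J.length ≠ n → u J = 0}
  add_mem' := fun {u v} hu hv J hJ => by simp [hu J hJ, hv J hJ]
  zero_mem' := fun _ _ => rfl
  smul_mem' := fun c u hu J hJ => by simp [hu J hJ]

theorem mem_degree_succ {n : ℕ} {u : WordFun ι} :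
    u ∈ degree ι (n + 1) ↔ u [] = 0 ∧ ∀ i, slice i u ∈ degree ι n := by
  constructor
  · intro h
    exact ⟨h [] (by simp), fun i J hJ => h (i :: J) (by simpa using hJ)⟩
  · rintro ⟨h0, h⟩ J hJ
    cases J with
    | nil => exact h0
    | cons i J => exact h i J (by simpa using hJ)

theorem mem_degree_zero {u : WordFun ι} : u ∈ degree ι 0 ↔ ∀ i, slice i u = 0 := by
  constructor
  · intro h i
    funext J
    exact h (i :: J) (by simp)
  · intro h J hJ
    cases J with
    | nil => simp at hJ
    | cons i J => exact congrFun (h i) J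

theorem slice_mem {n : ℕ} {u : WordFun ι} (h : u ∈ degree ι (n + 1)) (i : ι) :
    slice i u ∈ degree ι n := (mem_degree_succ.1 h).2 i

theorem nil_of_mem {n : ℕ} {u : WordFun ι} (h : u ∈ degree ι (n + 1)) : u [] = 0 :=
  (mem_degree_succ.1 h).1

theorem one_mem : (one : WordFun ι) ∈ degree ι 0 := mem_degree_zero.2 slice_one

theorem eq_smul_one {u : WordFun ι} (h : u ∈ degree ι 0) : u = u [] • one :=
  ext_slice (by simp) fun i => by simp [mem_degree_zero.1 h i]

end WordFun

/-! ### The operators `sign`, `left`, `right`, `del` and their commutation rules -/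

namespace LetterData

open WordFun

variable {ι : Type*} (S : LetterData ι)

/-- The sign of a word. -/
def signAux : List ι → ℂ
  | [] => 1
  | i :: J => S.sgn i * signAux J

/-- Multiplication by the sign of the word. -/
def sign : WordFun ι →ₗ[ℂ] WordFun ι where
  toFun u J := S.signAux J * u J
  map_add' u v := by funext J; simp [mul_add]
  map_smul' c u := by funext J; simp; ring

@[simp] theorem sign_nil (u : WordFun ι) : S.sign u [] = u [] := by simp [sign, signAux]

@[simp] theorem slice_sign (u : WordFun ι) (i : ι) :
    slice i (S.sign u) = S.sgn i • S.sign (slice i u) := by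
  funext J
  simp [sign, signAux, slice_apply, mul_assoc]

variable [DecidableEq ι]

/-- Multiplication by the letter `a` from the left. -/
def left : WordFun ι →ₗ[ℂ] WordFun ι where
  toFun u := assemble fun i => if i = S.a then u else 0
  map_add' u v := ext_slice (by simp) fun i => by
    simp only [map_add, slice_assemble]; split_ifs <;> simp
  map_smul' c u := ext_slice (by simp) fun i => by
    simp only [map_smul, slice_assemble, RingHom.id_apply]; split_ifs <;> simp

@[simp] theorem left_nil (u : WordFun ι) : S.left u [] = 0 := rfl

@[simp] theorem slice_left (u : WordFun ι) (i : ι) :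
    slice i (S.left u) = if i = S.a then u else 0 := rfl

/-- The value of `right c u` at a word. -/
def rightAux (c : ι) : List ι → WordFun ι → ℂ
  | [], _ => 0
  | i :: J, u => S.sgn i * rightAux c J (slice i u) + if i = c then u [] * one J else 0

/-- Multiplication by the letter `c` from the right, preceded by the sign of the word. -/
def right (c : ι) : WordFun ι →ₗ[ℂ] WordFun ι where
  toFun u J := S.rightAux c J u
  map_add' u v := by
    funext J
    simp only [Pi.add_apply]
    induction J generalizing u v with
    | nil => simp [rightAux]
    | cons i J ih =>
      simp only [rightAux, map_add, ih, Pi.add_apply]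
      split_ifs <;> ring
  map_smul' c u := by
    funext J
    simp only [Pi.smul_apply, RingHom.id_apply, smul_eq_mul]
    induction J generalizing u with
    | nil => simp [rightAux]
    | cons i J ih =>
      simp only [rightAux, map_smul, ih, Pi.smul_apply, smul_eq_mul]
      split_ifs <;> ring

@[simp] theorem right_nil (c : ι) (u : WordFun ι) : S.right c u [] = 0 := rfl

@[simp] theorem slice_right (c : ι) (u : WordFun ι) (i : ι) :
    slice i (S.right c u) =
      S.sgn i • S.right c (slice i u) + if i = c then u [] • one else 0 := by
  funext J
  simp only [slice_apply, right, LinearMap.coe_mk, AddHom.coe_mk, rightAux, Pi.add_apply,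
    Pi.smul_apply, smul_eq_mul]
  split_ifs <;> simp

/-- The value of `del u` at a word. -/
def delAux : List ι → WordFun ι → ℂ
  | [], _ => 0
  | i :: J, u => S.sgn i * delAux J (slice i u) + if i = S.a then S.left (slice S.b u) J else 0

/-- The odd derivation that sends the letter `b` to `aa` and the other letters to zero. -/
def del : WordFun ι →ₗ[ℂ] WordFun ι where
  toFun u J := S.delAux J u
  map_add' u v := by
    funext J
    simp only [Pi.add_apply]
    induction J generalizing u v with
    | nil => simp [delAux]
    | cons i J ih =>
      simp only [delAux, map_add, ih, Pi.add_apply]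
      split_ifs <;> ring
  map_smul' c u := by
    funext J
    simp only [Pi.smul_apply, RingHom.id_apply, smul_eq_mul]
    induction J generalizing u with
    | nil => simp [delAux]
    | cons i J ih =>
      simp only [delAux, map_smul, ih, Pi.smul_apply, smul_eq_mul]
      split_ifs <;> ring

@[simp] theorem del_nil (u : WordFun ι) : S.del u [] = 0 := rfl

@[simp] theorem slice_del (u : WordFun ι) (i : ι) :
    slice i (S.del u) =
      S.sgn i • S.del (slice i u) + if i = S.a then S.left (slice S.b u) else 0 := by
  funext J
  simp only [slice_apply, del, LinearMap.coe_mk, AddHom.coe_mk, delAux, Pi.add_apply,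
    Pi.smul_apply, smul_eq_mul]
  split_ifs <;> simp

@[simp] theorem del_one : S.del one = 0 := by
  refine ext_slice (by simp) fun i => ?_
  simp

theorem sign_one {ι : Type*} (S : LetterData ι) : S.sign one = one :=
  ext_slice (by simp) fun i => by simp

/-- The letter `a` is odd and is killed by `del`, so the Leibniz rule leaves only the sign. -/
theorem del_left (u : WordFun ι) : S.del (S.left u) = -S.left (S.del u) := by
  refine ext_slice (by simp) fun i => ?_
  have hba : S.b ≠ S.a := S.a_ne_b.symm
  by_cases hi : i = S.a
  · subst hi; simp [hba, S.sgn_a]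
  · simp [hi]

theorem right_left (c : ι) (u : WordFun ι) : S.right c (S.left u) = -S.left (S.right c u) := by
  refine ext_slice (by simp) fun i => ?_
  by_cases hi : i = S.a
  · subst hi; simp [S.sgn_a]
  · simp [hi]

theorem sign_left (u : WordFun ι) : S.sign (S.left u) = -S.left (S.sign u) := by
  refine ext_slice (by simp) fun i => ?_
  by_cases hi : i = S.a
  · subst hi; simp [S.sgn_a]
  · simp [hi]

theorem del_del (u : WordFun ι) : S.del (S.del u) = 0 := by
  suffices h : S.del ∘ₗ S.del = 0 from LinearMap.congr_fun h u
  refine eq_of_slice (by simp) fun J ih i u => ?_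
  have h := ih (slice i u)
  simp only [LinearMap.comp_apply, LinearMap.zero_apply, Pi.zero_apply] at h
  by_cases hi : i = S.a
  · subst hi; simp [S.sgn_a, S.sgn_b, del_left, S.a_ne_b.symm, h]
  · simp [hi, h]

theorem del_right (u : WordFun ι) :
    S.del (S.right S.a u) = -S.right S.a (S.del u) := by
  suffices h : S.del ∘ₗ S.right S.a = -(S.right S.a ∘ₗ S.del) from LinearMap.congr_fun h u
  refine eq_of_slice (by simp) fun J ih i u => ?_
  have h := ih (slice i u)
  simp only [LinearMap.comp_apply, LinearMap.neg_apply, Pi.neg_apply] at h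
  by_cases hi : i = S.a
  · subst hi; simp [S.sgn_a, S.sgn_b, right_left, S.a_ne_b.symm, h]; ring
  · simp [hi, h]

/-- The extra term is the derivative of the appended letter: `b` becomes `aa`. -/
theorem del_right_b (u : WordFun ι) :
    S.del (S.right S.b u) = -S.right S.b (S.del u) - S.right S.a (S.right S.a u) := by
  suffices h : S.del ∘ₗ S.right S.b =
      -(S.right S.b ∘ₗ S.del) - S.right S.a ∘ₗ S.right S.a from LinearMap.congr_fun h u
  refine eq_of_slice (by simp) fun J ih i u => ?_
  have h := ih (slice i u)
  -- On the empty word appending and prepending `a` agree; this matches the contributions of `u []`.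
  have h1 : S.right S.a one = S.left one := ext_slice (by simp) fun i => by simp
  simp only [LinearMap.comp_apply, LinearMap.neg_apply, Pi.neg_apply, LinearMap.sub_apply,
    Pi.sub_apply] at h
  have hs := S.sgn_mul_self i
  by_cases hi : i = S.a
  · subst hi; simp [S.sgn_a, S.sgn_b, right_left, S.a_ne_b, h, h1]; ring
  · by_cases hb : i = S.b
    · subst hb; simp [hi, h, S.sgn_b]
    · simp [hi, h, hb]
      ring

theorem sign_del (u : WordFun ι) : S.sign (S.del u) = -S.del (S.sign u) := by
  suffices h : S.sign ∘ₗ S.del = -(S.del ∘ₗ S.sign) from LinearMap.congr_fun h u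
  refine eq_of_slice (by simp) fun J ih i u => ?_
  have h := ih (slice i u)
  simp only [LinearMap.comp_apply, LinearMap.neg_apply, Pi.neg_apply] at h
  by_cases hi : i = S.a
  · subst hi; simp [S.sgn_a, S.sgn_b, sign_left, h]
  · simp [hi, h]

theorem sign_right (c : ι) (hc : S.sgn c = -1) (u : WordFun ι) :
    S.sign (S.right c u) = -S.right c (S.sign u) := by
  suffices h : S.sign ∘ₗ S.right c = -(S.right c ∘ₗ S.sign) from LinearMap.congr_fun h u
  refine eq_of_slice (by simp) fun J ih i u => ?_
  have h := ih (slice i u)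
  simp only [LinearMap.comp_apply, LinearMap.neg_apply, Pi.neg_apply] at h
  by_cases hi : i = c
  · subst hi; simp [hc, h, sign_one]
  · simp [hi, h]

theorem sign_sign {ι : Type*} (S : LetterData ι) (u : WordFun ι) : S.sign (S.sign u) = u := by
  suffices h : S.sign ∘ₗ S.sign = LinearMap.id from LinearMap.congr_fun h u
  refine eq_of_slice (by simp) fun J ih i u => ?_
  have h := ih (slice i u)
  simp only [LinearMap.comp_apply, LinearMap.id_apply] at h
  simp [h, ← mul_assoc, S.sgn_mul_self]

theorem left_mem {n : ℕ} {u : WordFun ι} (h : u ∈ degree ι n) : S.left u ∈ degree ι (n + 1) := by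
  refine mem_degree_succ.2 ⟨by simp, fun i => ?_⟩
  rw [slice_left]
  split_ifs
  exacts [h, zero_mem _]

theorem right_mem (c : ι) {n : ℕ} {u : WordFun ι} (h : u ∈ degree ι n) :
    S.right c u ∈ degree ι (n + 1) := by
  induction n generalizing u with
  | zero =>
    refine mem_degree_succ.2 ⟨by simp, fun i => ?_⟩
    rw [slice_right, mem_degree_zero.1 h i, map_zero, smul_zero, zero_add]
    split_ifs
    exacts [Submodule.smul_mem _ _ one_mem, zero_mem _]
  | succ n ih =>
    refine mem_degree_succ.2 ⟨by simp, fun i => ?_⟩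
    rw [slice_right, nil_of_mem h, zero_smul, ite_self, add_zero]
    exact Submodule.smul_mem _ _ (ih (slice_mem h i))

theorem del_eq_zero_of_mem_zero {u : WordFun ι} (h : u ∈ degree ι 0) : S.del u = 0 := by
  rw [eq_smul_one h, map_smul, del_one, smul_zero]

theorem del_mem {n : ℕ} {u : WordFun ι} (h : u ∈ degree ι n) : S.del u ∈ degree ι (n + 1) := by
  induction n generalizing u with
  | zero => rw [S.del_eq_zero_of_mem_zero h]; exact zero_mem _
  | succ n ih =>
    refine mem_degree_succ.2 ⟨by simp, fun i => ?_⟩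
    rw [slice_del]
    refine add_mem (Submodule.smul_mem _ _ (ih (slice_mem h i))) ?_
    split_ifs
    exacts [S.left_mem (slice_mem h _), zero_mem _]

theorem sign_mem {ι : Type*} (S : LetterData ι) {n : ℕ} {u : WordFun ι} (h : u ∈ degree ι n) : S.sign u ∈ degree ι n :=
  fun J hJ => by simp [sign, h J hJ]

end LetterData

/-! ### Dimension of the functions on words of fixed length -/

namespace WordFun

variable {ι : Type*}

/-- A function supported on the empty word is a scalar. -/
def degreeZeroEquiv : degree ι 0 ≃ₗ[ℂ] ℂ where
  toFun u := u.1 []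
  map_add' _ _ := rfl
  map_smul' _ _ := rfl
  invFun c := ⟨c • one, Submodule.smul_mem _ _ one_mem⟩
  left_inv u := Subtype.ext (eq_smul_one u.2).symm
  right_inv c := by simp

/-- A function supported on words of length `n + 1` is given by its slices. -/
def degreeSuccEquiv (n : ℕ) : degree ι (n + 1) ≃ₗ[ℂ] (ι → degree ι n) where
  toFun u i := ⟨slice i u.1, slice_mem u.2 i⟩
  map_add' _ _ := rfl
  map_smul' _ _ := rfl
  invFun f := ⟨assemble fun i => (f i).1, mem_degree_succ.2 ⟨rfl, fun i => (f i).2⟩⟩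
  left_inv u := Subtype.ext (ext_slice (nil_of_mem u.2).symm fun _ => rfl)
  right_inv _ := rfl

instance [Finite ι] (n : ℕ) : Module.Finite ℂ (degree ι n) := by
  induction n with
  | zero => exact Module.Finite.equiv degreeZeroEquiv.symm
  | succ n ih => exact Module.Finite.equiv (degreeSuccEquiv n).symm

theorem finrank_degree [Fintype ι] (n : ℕ) :
    Module.finrank ℂ (degree ι n) = Fintype.card ι ^ n := by
  induction n with
  | zero => rw [degreeZeroEquiv.finrank_eq]; simp
  | succ n ih =>
    rw [(degreeSuccEquiv n).finrank_eq, Module.finrank_pi_fintype]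
    simp [ih, pow_succ']

end WordFun

/-! ### The cycle equations solved on leading letters -/

namespace LetterData

open WordFun

variable {ι : Type*} (S : LetterData ι)

/-- The letters other than `a` and `b`. -/
abbrev Rest : Type _ := {i : ι // i ≠ S.a ∧ i ≠ S.b}

theorem forall_letter {p : ι → Prop} :
    (∀ i, p i) ↔ p S.a ∧ p S.b ∧ ∀ x : S.Rest, p x := by
  refine ⟨fun h => ⟨h _, h _, fun x => h _⟩, fun ⟨ha, hb, hx⟩ i => ?_⟩
  by_cases h1 : i = S.a
  · exact h1 ▸ ha
  by_cases h2 : i = S.b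
  · exact h2 ▸ hb
  exact hx ⟨i, h1, h2⟩

theorem card_rest [Fintype ι] [Fintype S.Rest] :
    Fintype.card ι = Fintype.card S.Rest + 2 := by
  classical
  have h : Fintype.card S.Rest = (({S.a, S.b} : Finset ι)ᶜ).card :=
    Fintype.card_of_subtype _ fun i => by simp
  rw [h, Finset.card_compl, Finset.card_pair S.a_ne_b]
  have : ({S.a, S.b} : Finset ι).card ≤ Fintype.card ι := Finset.card_le_univ _
  rw [Finset.card_pair S.a_ne_b] at this
  omega

variable [DecidableEq ι]

/-- A family indexed by letters, given on `a`, on `b`, and on the other letters. -/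
def pick {M : Type*} (fa fb : M) (fx : S.Rest → M) (i : ι) : M :=
  if ha : i = S.a then fa else if hb : i = S.b then fb else fx ⟨i, ha, hb⟩

section pick
variable {M : Type*} (fa fb : M) (fx : S.Rest → M)

@[simp] theorem pick_a : S.pick fa fb fx S.a = fa := by simp [pick]

@[simp] theorem pick_b : S.pick fa fb fx S.b = fb := by simp [pick, S.a_ne_b.symm]

@[simp] theorem pick_rest (x : S.Rest) : S.pick fa fb fx x = fx x := by
  simp [pick, x.2.1, x.2.2]

end pick

theorem sgn_ne_zero {ι : Type*} (S : LetterData ι) (i : ι) : S.sgn i ≠ 0 := fun h => by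
  simpa [h] using S.sgn_mul_self i

theorem ext_letter {ι : Type*} (S : LetterData ι) {u v : WordFun ι} : u = v ↔ u [] = v [] ∧ slice S.a u = slice S.a v ∧
    slice S.b u = slice S.b v ∧ ∀ x : S.Rest, slice x.1 u = slice x.1 v := by
  rw [← S.forall_letter (p := fun i => slice i u = slice i v)]
  exact ⟨fun h => by simp [h], fun h => ext_slice h.1 h.2⟩

theorem slice_a_del (u : WordFun ι) :
    slice S.a (S.del u) = S.left (slice S.b u) - S.del (slice S.a u) := by
  simp [S.sgn_a, sub_eq_neg_add]

theorem slice_b_del (u : WordFun ι) : slice S.b (S.del u) = -S.del (slice S.b u) := by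
  simp [S.sgn_b, S.a_ne_b.symm]

theorem slice_rest_del (u : WordFun ι) (x : S.Rest) :
    slice x.1 (S.del u) = S.sgn x.1 • S.del (slice x.1 u) := by
  simp [x.2.1]

/-- With `w_i` for slices, the leading-`a` part of the equation is `a w_b = del w_a`. Its own
leading-`a` part determines `w_b` from `w_ab` and `w_aa`; its other parts make `w_ab` and each
`w_ax` cycles, while `w_aa` stays free. -/
theorem del_eq_zero_iff {w : WordFun ι} : S.del w = 0 ↔
    slice S.b w = S.left (slice S.b (slice S.a w)) - S.del (slice S.a (slice S.a w)) ∧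
    S.del (slice S.b (slice S.a w)) = 0 ∧
    ∀ x : S.Rest, S.del (slice x.1 (slice S.a w)) = 0 ∧ S.del (slice x.1 w) = 0 := by
  have hsm : ∀ (x : S.Rest) (u : WordFun ι), S.sgn x.1 • u = 0 ↔ u = 0 := fun x u =>
    smul_eq_zero_iff_right (S.sgn_ne_zero _)
  rw [S.ext_letter, slice_a_del, slice_b_del]
  simp only [slice_rest_del, map_zero, sub_eq_zero, neg_eq_zero, hsm, del_nil, Pi.zero_apply,
    true_and]
  rw [S.ext_letter (u := S.left _), slice_a_del, slice_b_del]
  simp only [slice_rest_del, slice_left, if_true, S.a_ne_b.symm, if_false, left_nil, del_nil,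
    true_and]
  constructor
  · rintro ⟨⟨h1, h2, h3⟩, -, h5⟩
    refine ⟨h1, neg_eq_zero.1 h2.symm, fun x => ⟨?_, h5 x⟩⟩
    have := h3 x
    rw [if_neg x.2.1, eq_comm, hsm] at this
    exact this
  · rintro ⟨h1, h2, h3⟩
    refine ⟨⟨h1, by simp [h2], fun x => ?_⟩, ?_, fun x => (h3 x).2⟩
    · rw [if_neg x.2.1, (h3 x).1, smul_zero]
    -- The equation `del w_b = 0` follows from the formula for `w_b`.
    · rw [h1, map_sub, del_left, h2, del_del, map_zero, neg_zero, sub_zero]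

/-- The defect `L u - R u` of commuting with `a`. -/
def adA : WordFun ι →ₗ[ℂ] WordFun ι := S.left - S.right S.a

theorem adA_apply (u : WordFun ι) : S.adA u = S.left u - S.right S.a u := rfl

/-- Expanding two letters determines `u_b`, `v_b` and every `u_x`. The remaining equations become
cycle equations after a change of variables: `(u_ab, v_ab + u_aa)` is again a cone cycle, and each
`v_x` needs a correction by `right` terms to become a `del`-cycle. The hypotheses remove words of
length at most one, on which an appended letter would land among the two letters peeled off. -/
theorem pair_iff {u v : WordFun ι} (h0 : u [] = 0) (h1 : ∀ i, slice i u [] = 0) :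
    (S.del u = 0 ∧ S.del v = S.adA u) ↔
    slice S.b u = S.left (slice S.b (slice S.a u)) - S.del (slice S.a (slice S.a u)) ∧
    slice S.b v = slice S.a u - S.right S.a (slice S.a (slice S.a u))
      + S.left (slice S.b (slice S.a v)) - S.del (slice S.a (slice S.a v)) ∧
    (S.del (slice S.b (slice S.a u)) = 0 ∧
      S.del (slice S.b (slice S.a v) + slice S.a (slice S.a u)) =
        S.adA (slice S.b (slice S.a u))) ∧
    ∀ x : S.Rest, S.del (slice x.1 (slice S.a u)) = 0 ∧
      slice x.1 u = -S.sgn x.1 • (S.del (slice x.1 (slice S.a v)) +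
        S.right S.a (slice x.1 (slice S.a u))) ∧
      S.del (slice x.1 v + S.sgn x.1 • (S.right S.a (slice x.1 (slice S.a v)) +
        S.right S.b (slice x.1 (slice S.a u)))) = 0 := by
  have hba : S.b ≠ S.a := S.a_ne_b.symm
  -- The raw slice equations, before those for `u` are used to simplify them.
  have key : S.del v = S.adA u ↔
      (slice S.b v = slice S.a u - S.right S.a (slice S.a (slice S.a u))
        + S.left (slice S.b (slice S.a v)) - S.del (slice S.a (slice S.a v)) ∧
      S.del (slice S.b (slice S.a v)) = slice S.b u - S.right S.a (slice S.b (slice S.a u)) ∧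
      ∀ x : S.Rest, slice x.1 u = -S.sgn x.1 • (S.del (slice x.1 (slice S.a v)) +
        S.right S.a (slice x.1 (slice S.a u)))) ∧
      S.del (slice S.b v) = -S.right S.a (slice S.b u) ∧
      ∀ x : S.Rest, S.del (slice x.1 v) = - S.right S.a (slice x.1 u) := by
    have e1 : slice S.a (S.adA u) = u + S.right S.a (slice S.a u) := by
      simp [adA_apply, S.sgn_a, h0]
    have e2 : slice S.b (S.adA u) = S.right S.a (slice S.b u) := by
      simp [adA_apply, S.sgn_b, hba]
    have e3 : ∀ x : S.Rest, slice x.1 (S.adA u) = -(S.sgn x.1 • S.right S.a (slice x.1 u)) :=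
      fun x => by simp [adA_apply, x.2.1]
    have e4 : slice S.a (u + S.right S.a (slice S.a u)) =
        slice S.a u - S.right S.a (slice S.a (slice S.a u)) := by
      simp [S.sgn_a, h1, sub_eq_add_neg]
    have e5 : slice S.b (u + S.right S.a (slice S.a u)) =
        slice S.b u - S.right S.a (slice S.b (slice S.a u)) := by
      simp [S.sgn_b, hba, sub_eq_add_neg]
    have e6 : ∀ x : S.Rest, slice x.1 (u + S.right S.a (slice S.a u)) =
        slice x.1 u + S.sgn x.1 • S.right S.a (slice x.1 (slice S.a u)) :=
      fun x => by simp [x.2.1]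
    have e7 : slice S.a (S.left (slice S.b v)) = slice S.b v := by simp
    have e8 : slice S.b (S.left (slice S.b v)) = 0 := by simp [hba]
    have e9 : ∀ x : S.Rest, slice x.1 (S.left (slice S.b v)) = 0 := fun x => by simp [x.2.1]
    have c1 : S.del v [] = S.adA u [] ↔ True := by simp [adA_apply]
    have c2 : (S.left (slice S.b v) - S.del (slice S.a v)) [] =
        (u + S.right S.a (slice S.a u)) [] ↔ True := by simp [h0]
    have c3 : ∀ x : S.Rest, -(S.sgn x.1 • S.del (slice x.1 (slice S.a v))) =
        slice x.1 u + S.sgn x.1 • S.right S.a (slice x.1 (slice S.a u)) ↔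
        slice x.1 u = -S.sgn x.1 • (S.del (slice x.1 (slice S.a v)) +
        S.right S.a (slice x.1 (slice S.a u))) := fun x => by
      rw [neg_smul, smul_add, neg_add, eq_comm, ← eq_sub_iff_add_eq, sub_eq_add_neg]
    have c4 : ∀ x : S.Rest, S.sgn x.1 • S.del (slice x.1 v) =
        -(S.sgn x.1 • S.right S.a (slice x.1 u)) ↔
        S.del (slice x.1 v) = - S.right S.a (slice x.1 u) := fun x => by
      rw [← smul_neg, (smul_right_injective _ (S.sgn_ne_zero x.1)).eq_iff]
    rw [S.ext_letter, c1, slice_a_del, slice_b_del, e1, e2]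
    simp only [slice_rest_del, e3, c4]
    rw [S.ext_letter (u := _ - _), c2, map_sub, map_sub, slice_a_del, slice_b_del, e4, e5, e7, e8]
    simp only [map_sub, slice_rest_del, e6, e9, zero_sub, c3, true_and, neg_neg]
    rw [neg_eq_iff_eq_neg]
    refine and_congr_left' (and_congr_left' ?_)
    constructor <;> intro h
    · linear_combination h
    · linear_combination h
  -- By `del_right_b`, the obstruction to `v_x` being a cycle is exact; the primitive found here is
  -- the correction term.
  have hQ : ∀ {k : WordFun ι}, S.del k = 0 → ∀ m : WordFun ι,
      S.right S.a (S.del m + S.right S.a k) = -S.del (S.right S.a m + S.right S.b k) :=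
    fun {k} hk m => by
      rw [map_add, map_add, del_right, del_right_b, hk, map_zero]
      abel
  rw [key, del_eq_zero_iff]
  constructor
  · rintro ⟨⟨hub, hJ, hx⟩, ⟨hvb, hab, hax⟩, -, hv⟩
    refine ⟨hub, hvb, ⟨hJ, ?_⟩, fun x => ⟨(hx x).1, hax x, ?_⟩⟩
    · rw [map_add, hab, hub, adA_apply]
      abel
    · rw [map_add, hv x, map_smul, hax x, map_smul, hQ (hx x).1, neg_smul, smul_neg, neg_neg,
        neg_add_cancel]
  · rintro ⟨hub, hvb, ⟨hJ, hab⟩, hx⟩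
    have hab' : S.del (slice S.b (slice S.a v)) =
        slice S.b u - S.right S.a (slice S.b (slice S.a u)) := by
      rw [map_add, adA_apply] at hab
      rw [hub, eq_sub_of_add_eq hab]
      abel
    have hu : S.del u = 0 := by
      refine S.del_eq_zero_iff.2 ⟨hub, hJ, fun x => ⟨(hx x).1, ?_⟩⟩
      rw [(hx x).2.1, map_smul, map_add, del_del, del_right, (hx x).1]
      simp
    refine ⟨S.del_eq_zero_iff.1 hu, ⟨hvb, hab', fun x => (hx x).2.1⟩, ?_, fun x => ?_⟩
    -- The equation for `del v_b` is redundant: it follows from the formula for `v_b` and `del u =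
    -- 0`.
    · have hua : S.left (slice S.b u) = S.del (slice S.a u) := by
        have := S.slice_a_del u
        rw [hu, map_zero] at this
        exact (sub_eq_zero.1 this.symm)
      rw [hvb, map_sub, map_add, map_sub, ← hua, del_del, del_left, hab', del_right, hub]
      simp only [map_sub, right_left]
      abel
    · have h := (hx x).2.2
      rw [map_add, map_smul] at h
      rw [(hx x).2.1, map_smul, hQ (hx x).1, eq_neg_of_add_eq_zero_left h, neg_smul, smul_neg,
        neg_neg]

/-! ### Cycle spaces and their recursive descriptions -/

/-- The cycles of `del` supported on words of length `n`. -/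
def cyc (n : ℕ) : Submodule ℂ (WordFun ι) := degree ι n ⊓ LinearMap.ker S.del

/-- The cycles of the mapping cone of `adA`. -/
def pairCyc (n : ℕ) : Submodule ℂ (WordFun ι × WordFun ι) :=
  (degree ι n).prod (degree ι n) ⊓ (LinearMap.ker (S.del ∘ₗ LinearMap.fst ℂ _ _) ⊓
    LinearMap.ker (S.del ∘ₗ LinearMap.snd ℂ _ _ - S.adA ∘ₗ LinearMap.fst ℂ _ _))

theorem mem_pairCyc {n : ℕ} {p : WordFun ι × WordFun ι} : p ∈ S.pairCyc n ↔
    (p.1 ∈ degree ι n ∧ p.2 ∈ degree ι n) ∧ S.del p.1 = 0 ∧ S.del p.2 = S.adA p.1 := by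
  rw [← sub_eq_zero (a := S.del p.2)]; rfl

theorem adA_mem {n : ℕ} {u : WordFun ι} (h : u ∈ degree ι n) : S.adA u ∈ degree ι (n + 1) :=
  sub_mem (S.left_mem h) (S.right_mem _ h)

theorem mem_degree_succ_iff {ι : Type*} (S : LetterData ι) {n : ℕ} {u : WordFun ι} : u ∈ degree ι (n + 1) ↔ u [] = 0 ∧
    slice S.a u ∈ degree ι n ∧ slice S.b u ∈ degree ι n ∧
    ∀ x : S.Rest, slice x.1 u ∈ degree ι n := by
  rw [mem_degree_succ, S.forall_letter]

/-- The function with prescribed slices at `a`, at `b`, and at the other letters. -/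
def build (fa fb : WordFun ι) (fx : S.Rest → WordFun ι) : WordFun ι := assemble (S.pick fa fb fx)

section build
variable (fa fb : WordFun ι) (fx : S.Rest → WordFun ι)

@[simp] theorem build_nil : S.build fa fb fx [] = 0 := rfl

@[simp] theorem slice_a_build : slice S.a (S.build fa fb fx) = fa := by simp [build]

@[simp] theorem slice_b_build : slice S.b (S.build fa fb fx) = fb := by simp [build]

@[simp] theorem slice_rest_build (x : S.Rest) : slice x.1 (S.build fa fb fx) = fx x := by
  simp [build]

theorem eq_build {u : WordFun ι} (h : u [] = 0) (ha : slice S.a u = fa) (hb : slice S.b u = fb)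
    (hx : ∀ x : S.Rest, slice x.1 u = fx x) : S.build fa fb fx = u :=
  S.ext_letter.2 ⟨by simp [h], by simp [ha], by simp [hb], fun x => by simp [hx]⟩

variable {fa fb fx} in
theorem build_mem {n : ℕ} (ha : fa ∈ degree ι n) (hb : fb ∈ degree ι n)
    (hx : ∀ x, fx x ∈ degree ι n) : S.build fa fb fx ∈ degree ι (n + 1) :=
  S.mem_degree_succ_iff.2 ⟨rfl, by simpa using ha, by simpa using hb, fun x => by simpa using hx x⟩

end build

/-- A cycle of length `n + 2` is determined by its coefficients at `aa`, `ab`, and, for every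
other letter `x`, at `ax` and `x`. -/
def cycEquiv (n : ℕ) :
    S.cyc (n + 2) ≃ₗ[ℂ] degree ι n × S.cyc n × (S.Rest → S.cyc n × S.cyc (n + 1)) where
  toFun w :=
    have h := S.del_eq_zero_iff.1 w.2.2
    have ha := slice_mem w.2.1 S.a
    (⟨slice S.a (slice S.a w.1), slice_mem ha _⟩,
      ⟨slice S.b (slice S.a w.1), slice_mem ha _, h.2.1⟩,
      fun x => (⟨slice x.1 (slice S.a w.1), slice_mem ha _, (h.2.2 x).1⟩,
        ⟨slice x.1 w.1, slice_mem w.2.1 _, (h.2.2 x).2⟩))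
  map_add' _ _ := rfl
  map_smul' _ _ := rfl
  invFun t := ⟨S.build (S.build t.1.1 t.2.1.1 fun x => (t.2.2 x).1.1)
      (S.left t.2.1.1 - S.del t.1.1) fun x => (t.2.2 x).2.1,
    S.build_mem (S.build_mem t.1.2 t.2.1.2.1 fun x => (t.2.2 x).1.2.1)
      (sub_mem (S.left_mem t.2.1.2.1) (S.del_mem t.1.2)) fun x => (t.2.2 x).2.2.1,
    S.del_eq_zero_iff.2 ⟨by simp, by simpa using t.2.1.2.2,
      fun x => ⟨by simpa using (t.2.2 x).1.2.2, by simpa using (t.2.2 x).2.2.2⟩⟩⟩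
  left_inv w := by
    have h := S.del_eq_zero_iff.1 w.2.2
    exact Subtype.ext (S.eq_build _ _ _ (nil_of_mem w.2.1)
      (S.eq_build _ _ _ (nil_of_mem (slice_mem w.2.1 _)) rfl rfl fun _ => rfl).symm
      h.1 fun _ => rfl)
  right_inv t := by
    refine Prod.ext (Subtype.ext ?_) (Prod.ext (Subtype.ext ?_) (funext fun x =>
      Prod.ext (Subtype.ext ?_) (Subtype.ext ?_))) <;> simp

/-- A cone cycle of length `n + 2` is determined by coefficients that can be chosen freely among
shorter cycles. -/
def pairCycEquiv (n : ℕ) :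
    S.pairCyc (n + 2) ≃ₗ[ℂ] degree ι n × degree ι n × S.pairCyc n ×
      (S.Rest → S.cyc n × degree ι n × S.cyc (n + 1)) where
  toFun w :=
    have hu := (S.mem_pairCyc.1 w.2).1.1
    have hv := (S.mem_pairCyc.1 w.2).1.2
    have h := (S.pair_iff (nil_of_mem hu) fun i => nil_of_mem (slice_mem hu i)).1
      (S.mem_pairCyc.1 w.2).2
    have hua := slice_mem hu S.a
    have hva := slice_mem hv S.a
    (⟨slice S.a (slice S.a w.1.1), slice_mem hua _⟩,
      ⟨slice S.a (slice S.a w.1.2), slice_mem hva _⟩,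
      ⟨(slice S.b (slice S.a w.1.1), slice S.b (slice S.a w.1.2) + slice S.a (slice S.a w.1.1)),
        S.mem_pairCyc.2 ⟨⟨slice_mem hua _, add_mem (slice_mem hva _) (slice_mem hua _)⟩,
          h.2.2.1⟩⟩,
      fun x => (⟨slice x.1 (slice S.a w.1.1), slice_mem hua _, (h.2.2.2 x).1⟩,
        ⟨slice x.1 (slice S.a w.1.2), slice_mem hva _⟩,
        ⟨slice x.1 w.1.2 + S.sgn x.1 • (S.right S.a (slice x.1 (slice S.a w.1.2)) +
          S.right S.b (slice x.1 (slice S.a w.1.1))),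
          add_mem (slice_mem hv _) (Submodule.smul_mem _ _ (add_mem
            (S.right_mem _ (slice_mem hva _)) (S.right_mem _ (slice_mem hua _)))),
          (h.2.2.2 x).2.2⟩))
  map_add' w w' := by
    refine Prod.ext rfl (Prod.ext rfl (Prod.ext (Subtype.ext (Prod.ext rfl ?_)) (funext fun x =>
      Prod.ext rfl (Prod.ext rfl (Subtype.ext ?_)))))
    · simp; abel
    · simp; abel
  map_smul' c w := by
    refine Prod.ext rfl (Prod.ext rfl (Prod.ext (Subtype.ext (Prod.ext rfl ?_)) (funext fun x =>
      Prod.ext rfl (Prod.ext rfl (Subtype.ext ?_)))))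
    · simp
    · simp [smul_comm c]
  invFun t :=
    let u := S.build (S.build t.1.1 t.2.2.1.1.1 fun x => (t.2.2.2 x).1.1)
      (S.left t.2.2.1.1.1 - S.del t.1.1)
      fun x => -S.sgn x.1 • (S.del (t.2.2.2 x).2.1.1 + S.right S.a (t.2.2.2 x).1.1)
    let v := S.build (S.build t.2.1.1 (t.2.2.1.1.2 - t.1.1) fun x => (t.2.2.2 x).2.1.1)
      (slice S.a u - S.right S.a t.1.1 + S.left (t.2.2.1.1.2 - t.1.1) - S.del t.2.1.1)
      fun x => (t.2.2.2 x).2.2.1 - S.sgn x.1 • (S.right S.a (t.2.2.2 x).2.1.1 +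
        S.right S.b (t.2.2.2 x).1.1)
    have hp := S.mem_pairCyc.1 t.2.2.1.2
    have hu : u ∈ degree ι (n + 2) := S.build_mem
      (S.build_mem t.1.2 hp.1.1 fun x => (t.2.2.2 x).1.2.1)
      (sub_mem (S.left_mem hp.1.1) (S.del_mem t.1.2)) fun x => Submodule.smul_mem _ _
        (add_mem (S.del_mem (t.2.2.2 x).2.1.2) (S.right_mem _ (t.2.2.2 x).1.2.1))
    have hJ := sub_mem hp.1.2 t.1.2
    have hv : v ∈ degree ι (n + 2) := S.build_mem
      (S.build_mem t.2.1.2 hJ fun x => (t.2.2.2 x).2.1.2)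
      (sub_mem (add_mem (sub_mem (slice_mem hu _) (S.right_mem _ t.1.2)) (S.left_mem hJ))
        (S.del_mem t.2.1.2))
      fun x => sub_mem (t.2.2.2 x).2.2.2.1 (Submodule.smul_mem _ _ (add_mem
        (S.right_mem _ (t.2.2.2 x).2.1.2) (S.right_mem _ (t.2.2.2 x).1.2.1)))
    ⟨(u, v), S.mem_pairCyc.2 ⟨⟨hu, hv⟩,
      (S.pair_iff (nil_of_mem hu) fun i => nil_of_mem (slice_mem hu i)).2
      ⟨by simp [u], by simp [u, v], ⟨by simpa [u] using hp.2.1, by simpa [u, v] using hp.2.2⟩,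
        fun x => ⟨by simpa [u] using (t.2.2.2 x).1.2.2, by simp [u, v],
          by simpa [u, v] using (t.2.2.2 x).2.2.2.2⟩⟩⟩⟩
  left_inv w := by
    have hu := (S.mem_pairCyc.1 w.2).1.1
    have hv := (S.mem_pairCyc.1 w.2).1.2
    have h := (S.pair_iff (nil_of_mem hu) fun i => nil_of_mem (slice_mem hu i)).1
      (S.mem_pairCyc.1 w.2).2
    refine Subtype.ext (Prod.ext ?_ ?_)
    · exact S.eq_build _ _ _ (nil_of_mem hu)
        (S.eq_build _ _ _ (nil_of_mem (slice_mem hu _)) rfl rfl fun _ => rfl).symm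
        h.1 fun x => (h.2.2.2 x).2.1
    · refine S.eq_build _ _ _ (nil_of_mem hv)
        (S.eq_build _ _ _ (nil_of_mem (slice_mem hv _)) rfl ?_ fun _ => rfl).symm ?_ fun x => ?_
      · simp
      · rw [h.2.1]
        simp only [slice_a_build, add_sub_cancel_right]
        rw [S.eq_build _ _ _ (nil_of_mem (slice_mem hu _)) rfl rfl fun _ => rfl]
      · simp
  right_inv t := by
    refine Prod.ext (Subtype.ext ?_) (Prod.ext (Subtype.ext ?_) (Prod.ext (Subtype.ext
      (Prod.ext ?_ ?_)) (funext fun x =>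
      Prod.ext (Subtype.ext ?_) (Prod.ext (Subtype.ext ?_) (Subtype.ext ?_))))) <;> simp

theorem right_a_eq_left {u : WordFun ι} (h : u ∈ degree ι 0) : S.right S.a u = S.left u := by
  refine ext_slice (by simp) fun i => ?_
  simp [mem_degree_zero.1 h i, ← eq_smul_one h]

theorem left_injective : Function.Injective S.left := fun u v h => by
  simpa using congrArg (slice S.a) h

theorem cyc_zero : S.cyc 0 = degree ι 0 :=
  inf_eq_left.2 fun _ h => S.del_eq_zero_of_mem_zero h

/-- Every pair of scalars is a cone cycle. -/
def pairCycZeroEquiv : S.pairCyc 0 ≃ₗ[ℂ] degree ι 0 × degree ι 0 where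
  toFun w := (⟨w.1.1, w.2.1.1⟩, ⟨w.1.2, w.2.1.2⟩)
  map_add' _ _ := rfl
  map_smul' _ _ := rfl
  invFun t := ⟨(t.1.1, t.2.1), S.mem_pairCyc.2 ⟨⟨t.1.2, t.2.2⟩, by
    rw [S.del_eq_zero_of_mem_zero t.1.2, S.del_eq_zero_of_mem_zero t.2.2, adA_apply,
      S.right_a_eq_left t.1.2, sub_self]
    exact ⟨rfl, rfl⟩⟩⟩
  left_inv _ := rfl
  right_inv _ := rfl

theorem del_eq_zero_iff_of_mem_one {w : WordFun ι} (h : w ∈ degree ι 1) :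
    S.del w = 0 ↔ slice S.b w = 0 := by
  have h0 : ∀ i j, slice j (slice i w) = 0 := fun i => mem_degree_zero.1 (slice_mem h i)
  have h1 : ∀ i, S.del (slice i w) = 0 := fun i => S.del_eq_zero_of_mem_zero (slice_mem h i)
  rw [del_eq_zero_iff]
  simp [h0, h1]

/-- A cycle of length one is a combination of the letters other than `b`. -/
def cycOneEquiv : S.cyc 1 ≃ₗ[ℂ] degree ι 0 × (S.Rest → degree ι 0) where
  toFun w := (⟨slice S.a w.1, slice_mem w.2.1 _⟩, fun x => ⟨slice x.1 w.1, slice_mem w.2.1 _⟩)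
  map_add' _ _ := rfl
  map_smul' _ _ := rfl
  invFun t :=
    have h : S.build t.1.1 0 (fun x => (t.2 x).1) ∈ degree ι 1 :=
      S.build_mem t.1.2 (zero_mem _) fun x => (t.2 x).2
    ⟨S.build t.1.1 0 fun x => (t.2 x).1, h, (S.del_eq_zero_iff_of_mem_one h).2 (by simp)⟩
  left_inv w := Subtype.ext (S.eq_build _ _ _ (nil_of_mem w.2.1) rfl
    ((S.del_eq_zero_iff_of_mem_one w.2.1).1 w.2.2) fun _ => rfl)
  right_inv t := by
    refine Prod.ext (Subtype.ext ?_) (funext fun x => Subtype.ext ?_) <;> simp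

/-- Because `a` is odd, `adA a = 2aa = del (2b)`, which forces the coefficient of `b` in `v`. For
another letter `x`, `adA x` has a term `ax` that is not in the image of `del`. -/
theorem pair_iff_of_mem_one {u v : WordFun ι} (hu : u ∈ degree ι 1) (hv : v ∈ degree ι 1) :
    (S.del u = 0 ∧ S.del v = S.adA u) ↔
      slice S.b u = 0 ∧ (∀ x : S.Rest, slice x.1 u = 0) ∧
        slice S.b v = slice S.a u + slice S.a u := by
  have hd : ∀ i, S.del (slice i v) = 0 := fun i => S.del_eq_zero_of_mem_zero (slice_mem hv i)
  have hr : ∀ i, S.right S.a (slice i u) = S.left (slice i u) :=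
    fun i => S.right_a_eq_left (slice_mem hu i)
  have h0 := nil_of_mem hu
  have hba : S.b ≠ S.a := S.a_ne_b.symm
  rw [S.del_eq_zero_iff_of_mem_one hu, and_congr_right_iff]
  intro hb
  rw [S.ext_letter]
  have e1 : slice S.a (S.adA u) = u + S.left (slice S.a u) := by
    simp [adA_apply, S.sgn_a, h0, hr]
  have e2 : slice S.b (S.adA u) = 0 := by simp [adA_apply, hba, hb]
  have e3 : ∀ x : S.Rest, slice x.1 (S.adA u) = -(S.sgn x.1 • S.left (slice x.1 u)) :=
    fun x => by simp [adA_apply, x.2.1, hr]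
  have e4 : ∀ x : S.Rest, S.left (slice x.1 u) = 0 ↔ slice x.1 u = 0 := fun x =>
    map_eq_zero_iff _ S.left_injective
  simp only [slice_a_del, slice_b_del, slice_rest_del, hd, e1, e2, e3, sub_zero, neg_zero,
    smul_zero, true_and, zero_eq_neg, smul_eq_zero_iff_right (S.sgn_ne_zero _), e4]
  rw [S.ext_letter]
  have e5 : ∀ x : S.Rest, slice x.1 (S.left (slice S.b v)) = 0 := fun x => by simp [x.2.1]
  have e6 : ∀ x : S.Rest, slice x.1 (S.left (slice S.a u)) = 0 := fun x => by simp [x.2.1]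
  simp only [map_add, e5, e6]
  simp [adA_apply, h0, hba, hb]
  simp only [eq_comm (a := (0 : WordFun ι))]
  tauto

/-- The cone cycles of length one. -/
def pairCycOneEquiv :
    S.pairCyc 1 ≃ₗ[ℂ] degree ι 0 × degree ι 0 × (S.Rest → degree ι 0) where
  toFun w :=
    have hu := (S.mem_pairCyc.1 w.2).1.1
    have hv := (S.mem_pairCyc.1 w.2).1.2
    (⟨slice S.a w.1.1, slice_mem hu _⟩, ⟨slice S.a w.1.2, slice_mem hv _⟩,
      fun x => ⟨slice x.1 w.1.2, slice_mem hv _⟩)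
  map_add' _ _ := rfl
  map_smul' _ _ := rfl
  invFun t :=
    have hu : S.build t.1.1 0 (fun _ => 0) ∈ degree ι 1 :=
      S.build_mem t.1.2 (zero_mem _) fun x => zero_mem _
    have hv : S.build t.2.1.1 (t.1.1 + t.1.1) (fun x => (t.2.2 x).1) ∈ degree ι 1 :=
      S.build_mem t.2.1.2 (add_mem t.1.2 t.1.2) fun x => (t.2.2 x).2
    ⟨(S.build t.1.1 0 fun _ => 0, S.build t.2.1.1 (t.1.1 + t.1.1) fun x => (t.2.2 x).1),
      S.mem_pairCyc.2 ⟨⟨hu, hv⟩, (S.pair_iff_of_mem_one hu hv).2 (by simp)⟩⟩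
  left_inv w := by
    have hu := (S.mem_pairCyc.1 w.2).1.1
    have hv := (S.mem_pairCyc.1 w.2).1.2
    have h := (S.pair_iff_of_mem_one hu hv).1 (S.mem_pairCyc.1 w.2).2
    exact Subtype.ext (Prod.ext (S.eq_build _ _ _ (nil_of_mem hu) rfl h.1 h.2.1)
      (S.eq_build _ _ _ (nil_of_mem hv) rfl h.2.2 fun _ => rfl))
  right_inv t := by
    refine Prod.ext (Subtype.ext ?_) (Prod.ext (Subtype.ext ?_)
      (funext fun x => Subtype.ext ?_)) <;> simp

instance [Finite ι] (n : ℕ) : Module.Finite ℂ (S.cyc n) :=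
  Submodule.finiteDimensional_of_le (S₂ := degree ι n) inf_le_left

instance [Finite ι] (n : ℕ) : Module.Finite ℂ (S.pairCyc n) := by
  have : Module.Finite ℂ ((degree ι n).prod (degree ι n)) :=
    Module.Finite.iff_fg.2 (Submodule.FG.prod (Module.Finite.iff_fg.1 inferInstance)
      (Module.Finite.iff_fg.1 inferInstance))
  exact Submodule.finiteDimensional_of_le (S₂ := (degree ι n).prod (degree ι n)) inf_le_left

/-! ### Dimension recurrences -/

section finrank

open Module

variable [Fintype ι]

/-- `cycEquiv` gives `z_{n+2} + z_{n+1} = (N+2)^n + (N+1)(z_{n+1} + z_n)`, a first-order recurrence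
for consecutive sums. -/
theorem finrank_cyc_add (n : ℕ) : finrank ℂ (S.cyc (n + 1)) + finrank ℂ (S.cyc n) =
    (Fintype.card S.Rest + 1) ^ (n + 1) + (Fintype.card S.Rest + 2) ^ n := by
  induction n with
  | zero =>
    rw [S.cycOneEquiv.finrank_eq, S.cyc_zero, finrank_prod, finrank_pi_fintype]
    simp [finrank_degree]
    ring
  | succ n ih =>
    rw [(S.cycEquiv n).finrank_eq, finrank_prod, finrank_prod, finrank_pi_fintype]
    simp only [finrank_prod, finrank_degree, S.card_rest, Finset.sum_const, Finset.card_univ,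
      smul_eq_mul]
    linear_combination (Fintype.card S.Rest + 1) * ih

/-- `pairCycEquiv` contains exactly one copy of `pairCyc n`, so the final `1`, present at `n = 0`,
is carried along unchanged. -/
theorem finrank_pairCyc_add (n : ℕ) :
    finrank ℂ (S.pairCyc (n + 1)) + finrank ℂ (S.pairCyc n) =
      2 * (Fintype.card S.Rest + 2) ^ n + (Fintype.card S.Rest + 1) ^ (n + 1) + 1 := by
  induction n with
  | zero =>
    rw [S.pairCycOneEquiv.finrank_eq, S.pairCycZeroEquiv.finrank_eq, finrank_prod, finrank_prod, finrank_prod,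
      finrank_pi_fintype]
    simp [finrank_degree]
    ring
  | succ n ih =>
    rw [(S.pairCycEquiv n).finrank_eq, finrank_prod, finrank_prod, finrank_prod,
      finrank_pi_fintype]
    simp only [finrank_prod, finrank_degree, S.card_rest, Finset.sum_const, Finset.card_univ,
      smul_eq_mul]
    linear_combination ih + Fintype.card S.Rest * S.finrank_cyc_add n

end finrank

end LetterData

/-! ### Coordinates of cochains -/

open WordFun

/-- The letters `f_1` and `f_s` with the signs given by parity. -/
def letters (r s : ℕ) (hs : 2 ≤ s) : LetterData (Idx r s) where
  sgn i := (-1) ^ par i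
  a := Sum.inr ⟨0, by omega⟩
  b := Sum.inr ⟨s - 1, by omega⟩
  sgn_mul_self i := by rw [← pow_add, ← two_mul, pow_mul]; simp
  sgn_a := by simp [par]
  sgn_b := by simp [par]
  a_ne_b := by simp; omega

variable {r s : ℕ}

/-- The coefficients of a cochain: `φ` is the formal sum of the `coord φ i J • φ^J_i`. -/
noncomputable def coord : Cochain r s ≃ₗ[ℂ] (Idx r s → WordFun (Idx r s)) where
  toFun φ i J := (basisW r s).repr (φ (word J)) i
  map_add' φ ψ := by ext; simp
  map_smul' c φ := by ext; simp
  invFun f := (wordBasis r s).constr ℂ fun J => ∑ i, f i J • basisW r s i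
  left_inv φ := (wordBasis r s).ext fun J => by
    rw [Module.Basis.constr_basis, wordBasis_apply]
    exact (basisW r s).sum_repr _
  right_inv f := by
    ext i J
    beta_reduce
    rw [← wordBasis_apply, Module.Basis.constr_basis, Module.Basis.repr_sum_self]

theorem coord_apply (φ : Cochain r s) (i : Idx r s) (J : List (Idx r s)) :
    coord φ i J = (basisW r s).repr (φ (word J)) i := rfl

theorem wordPar_cons (i : Idx r s) (J : List (Idx r s)) :
    wordPar (i :: J) = par i + wordPar J := by simp [wordPar]

theorem signAux_letters (hs : 2 ≤ s) (J : List (Idx r s)) :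
    (letters r s hs).signAux J = (-1) ^ wordPar J := by
  induction J with
  | nil => simp [LetterData.signAux, wordPar]
  | cons i J ih => rw [LetterData.signAux, ih, wordPar_cons, pow_add]; rfl

theorem coord_parityPart (p : ℕ) (φ : Cochain r s) (i : Idx r s) (J : List (Idx r s)) :
    coord (parityPart p φ) i J = if (wordPar J + par i) % 2 = p then coord φ i J else 0 := by
  rw [coord_apply, ← wordBasis_apply]
  simp only [parityPart, LinearMap.coe_mk, AddHom.coe_mk, Module.Basis.constr_basis]
  have : ∀ j : Idx r s, (if (wordPar J + par j) % 2 = p then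
      (basisW r s).repr (φ (word J)) j • basisW r s j else 0) =
      (if (wordPar J + par j) % 2 = p then coord φ j J else 0) • basisW r s j := fun j => by
    split_ifs <;> simp [coord_apply]
  simp only [this, Module.Basis.repr_sum_self]

theorem coord_basicCochain (I J : List (Idx r s)) (i j : Idx r s) :
    coord (basicCochain I i) j J = if I = J ∧ i = j then 1 else 0 := by
  rw [coord_apply, ← wordBasis_apply, basicCochain, Module.Basis.constr_basis]
  by_cases h : I = J <;> simp [h, Finsupp.single_apply]

theorem coord_comp (φ ψ : Cochain r s) (i : Idx r s) (x : List (Idx r s)) :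
    coord (comp φ ψ) i x =
      ∑ k ∈ Finset.range (x.length + 1), ∑ m ∈ Finset.range (x.length - k + 1), ∑ j : Idx r s,
        (-1) ^ (wordPar (x.take k) * (wordPar ((x.drop k).take m) + par j)) *
          coord ψ j ((x.drop k).take m) * coord φ i (x.take k ++ j :: (x.drop k).drop m) := by
  have h : comp φ ψ (word x) = φ (coderivation ψ (word x)) := rfl
  rw [coord_apply, h, ← wordBasis_apply]
  simp only [coderivation, LinearMap.coe_mk, AddHom.coe_mk, Module.Basis.constr_basis, map_sum,
    Finsupp.coe_finsetSum, Finset.sum_apply, map_smul, Finsupp.smul_apply, smul_eq_mul]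
  rfl

/-! ### The coboundary operator in coordinates -/

section

variable (hs : 2 ≤ s)

theorem coord_dNil (i : Idx r s) (J : List (Idx r s)) :
    coord (dNil r s hs) i J =
      if J = [(letters r s hs).a, (letters r s hs).a] ∧ i = (letters r s hs).b then 1 else 0 := by
  rw [dNil, coord_basicCochain]
  simp only [letters, eq_comm]
  congr

theorem del_eq_sum (w : WordFun (Idx r s)) (x : List (Idx r s)) :
    (letters r s hs).del w x = ∑ k ∈ Finset.range (x.length + 1),
      if (x.drop k).take 2 = [(letters r s hs).a, (letters r s hs).a] then
        (-1) ^ wordPar (x.take k) * w (x.take k ++ (letters r s hs).b :: (x.drop k).drop 2)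
      else 0 := by
  induction x generalizing w with
  | nil => simp
  | cons i J ih =>
    rw [← slice_apply i ((letters r s hs).del w), LetterData.slice_del, Pi.add_apply, Pi.smul_apply, smul_eq_mul, ih,
      List.length_cons, Finset.sum_range_succ' _ (J.length + 1)]
    congr 1
    · rw [Finset.mul_sum]
      refine Finset.sum_congr rfl fun k _ => ?_
      simp only [List.drop_succ_cons, List.take_succ_cons, wordPar_cons, pow_add, slice_apply,
        List.cons_append, mul_ite, mul_zero, mul_assoc]
      rfl
    · by_cases hi : i = (letters r s hs).a
      · subst hi
        cases J with
        | nil => simp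
        | cons j K =>
          rw [if_pos rfl, ← slice_apply j ((letters r s hs).left _), LetterData.slice_left]
          by_cases hj : j = (letters r s hs).a <;> simp [hj, slice_apply, wordPar]
      · simp [hi]

theorem coord_comp_dNil (φ : Cochain r s) (i : Idx r s) :
    coord (comp φ (dNil r s hs)) i = (letters r s hs).del (coord φ i) := by
  funext x
  rw [coord_comp, del_eq_sum]
  refine Finset.sum_congr rfl fun k hk => ?_
  simp only [coord_dNil]
  -- The `3` is `|aa| + |b|`, the unreduced parity of `d`.
  have hodd : ∀ p : ℕ, (-1 : ℂ) ^ (p * 3) = (-1) ^ p := fun p => by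
    rw [mul_comm, pow_mul]; norm_num
  have h1 : ∀ m ∈ Finset.range (x.length - k + 1), (∑ j : Idx r s,
      (-1 : ℂ) ^ (wordPar (x.take k) * (wordPar ((x.drop k).take m) + par j)) *
      (if (x.drop k).take m = [(letters r s hs).a, (letters r s hs).a] ∧ j = (letters r s hs).b
        then 1 else 0) * coord φ i (x.take k ++ j :: (x.drop k).drop m)) =
      if m = 2 then (if (x.drop k).take 2 = [(letters r s hs).a, (letters r s hs).a] then
        (-1) ^ wordPar (x.take k) *
          coord φ i (x.take k ++ (letters r s hs).b :: (x.drop k).drop 2) else 0) else 0 := by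
    intro m hm
    rw [Finset.mem_range] at hm
    rw [Finset.sum_eq_single (letters r s hs).b (fun j _ hj => by simp [hj]) (by simp)]
    by_cases h : (x.drop k).take m = [(letters r s hs).a, (letters r s hs).a]
    · have hm2 : m = 2 := by
        have := congrArg List.length h
        simp only [List.length_take, List.length_drop, List.length_cons, List.length_nil] at this
        omega
      subst hm2
      rw [h]
      have : wordPar [(letters r s hs).a, (letters r s hs).a] + par (letters r s hs).b = 3 := rfl
      simp [this, hodd]
    · by_cases hm2 : m = 2
      · subst hm2; simp [h]
      · simp [h, hm2]
  rw [Finset.sum_congr rfl h1, Finset.sum_ite_eq']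
  split_ifs with h2 h3 h3
  · rfl
  · rfl
  -- Fewer than two letters remain after position `k`, so they cannot begin with `aa`.
  · exfalso
    have := congrArg List.length h3
    simp only [List.length_take, List.length_drop, List.length_cons, List.length_nil] at this
    rw [Finset.mem_range] at h2
    omega
  · rfl

/-- The sign built into `right` cancels `sign`, leaving plain appending of `a`. -/
theorem right_sign_eq_sum (w : WordFun (Idx r s)) (x : List (Idx r s)) :
    (letters r s hs).right (letters r s hs).a ((letters r s hs).sign w) x =
      ∑ m ∈ Finset.range (x.length + 1),
        if x.drop m = [(letters r s hs).a] then w (x.take m) else 0 := by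
  induction x generalizing w with
  | nil => simp
  | cons i J ih =>
    rw [← slice_apply i ((letters r s hs).right _ _), LetterData.slice_right, Pi.add_apply, LetterData.slice_sign, map_smul,
      smul_smul, LetterData.sgn_mul_self, one_smul, ih, List.length_cons,
      Finset.sum_range_succ' _ (J.length + 1)]
    congr 1
    by_cases hi : i = (letters r s hs).a
    · cases J <;> simp [hi, one]
    · simp [hi]

theorem coord_dNil_comp (φ : Cochain r s) (i : Idx r s) :
    coord (comp (dNil r s hs) φ) i = if i = (letters r s hs).b then
      -(letters r s hs).adA ((letters r s hs).sign (coord φ (letters r s hs).a)) else 0 := by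
  funext x
  rw [coord_comp]
  simp only [coord_dNil]
  by_cases hi : i = (letters r s hs).b
  swap
  · simp [hi]
  simp only [hi, and_true, if_true]
  set a := (letters r s hs).a with ha
  have hpa : par a = 1 := rfl
  have h1 : ∀ (p : ℕ) (u v t : List (Idx r s)), (∑ j : Idx r s,
      (-1 : ℂ) ^ (p * (wordPar v + par j)) * coord φ j v *
        (if u ++ j :: t = [a, a] then 1 else 0)) =
      if u ++ a :: t = [a, a] then (-1) ^ (p * (wordPar v + 1)) * coord φ a v else 0 := by
    intro p u v t
    rw [Finset.sum_eq_single a ?_ (by simp)]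
    · simp [hpa]
    · intro j _ hj
      rw [if_neg, mul_zero]
      intro h
      have : j ∈ [a, a] := h ▸ by simp
      simp [hj] at this
  simp only [h1]
  have h2 : (-(letters r s hs).adA ((letters r s hs).sign (coord φ a))) x =
      (letters r s hs).right a ((letters r s hs).sign (coord φ a)) x
        - (letters r s hs).left ((letters r s hs).sign (coord φ a)) x := by
    rw [LetterData.adA_apply]; simp [ha]
  rw [h2, right_sign_eq_sum]
  cases x with
  | nil => simp
  | cons c K =>
    -- The output of `φ` must be one of the two letters of `aa`: `k = 0` gives right multiplication
    -- by `a`, `k = 1` left multiplication, and larger `k` nothing.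
    rw [List.length_cons, Finset.sum_range_succ', Finset.sum_range_succ', Finset.sum_eq_zero]
    · rw [zero_add, add_comm, sub_eq_add_neg]
      congr 1
      · simp [wordPar, ← ha]
      · rw [← slice_apply c ((letters r s hs).left _), LetterData.slice_left, ← ha]
        simp only [zero_add, List.take_succ_cons, List.take_zero, List.drop_succ_cons,
          List.drop_zero, Nat.add_sub_cancel]
        rw [Finset.sum_range_succ, Finset.sum_eq_zero]
        · by_cases hc : c = a
          · simp [hc, LetterData.sign, signAux_letters, wordPar_cons, hpa]
            simp [wordPar, pow_add]
          · simp [hc]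
        · intro m hm
          rw [Finset.mem_range] at hm
          rw [if_neg]
          simp; omega
    · intro k hk
      rw [Finset.mem_range] at hk
      refine Finset.sum_eq_zero fun m _ => if_neg fun h => ?_
      have := congrArg List.length h
      simp at this
      omega

theorem parityPart_dNil (p : ℕ) :
    parityPart p (dNil r s hs) = if p = 1 then dNil r s hs else 0 := by
  refine coord.injective (funext fun i => funext fun J => ?_)
  rw [coord_parityPart]
  have : ∀ (i : Idx r s) (J : List (Idx r s)), coord (dNil r s hs) i J ≠ 0 →
      (wordPar J + par i) % 2 = 1 := by
    intro i J h
    rw [coord_dNil] at h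
    obtain ⟨rfl, rfl⟩ := of_not_not fun h' => h (if_neg h')
    rw [show wordPar [(letters r s hs).a, (letters r s hs).a] + par (letters r s hs).b = 3 from rfl]
  by_cases h : coord (dNil r s hs) i J = 0
  · split_ifs <;> simp [h]
  · rw [this i J h]
    by_cases h1 : p = 1
    · simp [h1]
    · simp [h1, Ne.symm h1]

theorem coboundary_dNil (φ : Cochain r s) : coboundary (dNil r s hs) φ =
    comp (dNil r s hs) (parityPart 0 φ + parityPart 1 φ) -
      comp (parityPart 0 φ - parityPart 1 φ) (dNil r s hs) := by
  simp [coboundary, bracket, Finset.sum_range_succ, parityPart_dNil]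
  abel

/-- The bracket sign `(-1)^{|φ|}` is `(-1)^{|J|+|i|}` on the component `φ^J_i`, which produces `sgn
i` and the twist by `sign`. -/
theorem coord_coboundary_dNil (φ : Cochain r s) (i : Idx r s) :
    coord (coboundary (dNil r s hs) φ) i = (if i = (letters r s hs).b then
      -(letters r s hs).adA ((letters r s hs).sign (coord φ (letters r s hs).a)) else 0)
      - (letters r s hs).sgn i • (letters r s hs).del ((letters r s hs).sign (coord φ i)) := by
  have hsum : parityPart 0 φ + parityPart 1 φ = φ := by
    refine coord.injective (funext fun i => funext fun J => ?_)
    rw [map_add, Pi.add_apply, Pi.add_apply, coord_parityPart, coord_parityPart]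
    rcases Nat.mod_two_eq_zero_or_one (wordPar J + par i) with h | h <;> simp [h]
  have hdiff : coord (parityPart 0 φ - parityPart 1 φ) i =
      (letters r s hs).sgn i • (letters r s hs).sign (coord φ i) := by
    funext J
    rw [map_sub, Pi.sub_apply, Pi.sub_apply, coord_parityPart, coord_parityPart]
    have h2 : ((letters r s hs).sgn i • (letters r s hs).sign (coord φ i)) J =
        (-1) ^ (wordPar J + par i) * coord φ i J := by
      simp only [LetterData.sign, signAux_letters, Pi.smul_apply, LinearMap.coe_mk, AddHom.coe_mk,
        smul_eq_mul, pow_add]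
      rw [← mul_assoc, mul_comm ((-1) ^ wordPar J)]
      rfl
    rw [h2, neg_one_pow_eq_pow_mod_two]
    rcases Nat.mod_two_eq_zero_or_one (wordPar J + par i) with h | h <;> simp [h]
  rw [coboundary_dNil, hsum, map_sub, Pi.sub_apply, coord_dNil_comp, coord_comp_dNil, hdiff,
    map_smul]

end

/-! ### Cocycles, coboundaries and their dimensions -/

open WordFun Module

variable {r s : ℕ}

theorem mem_cochains {n : ℕ} {φ : Cochain r s} :
    φ ∈ cochains r s n ↔ ∀ i, coord φ i ∈ degree (Idx r s) n := by
  constructor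
  · intro h i J hJ
    rw [coord_apply, h J hJ]
    simp
  · intro h J hJ
    refine (basisW r s).repr.injective (Finsupp.ext fun i => ?_)
    rw [map_zero]
    exact h i J hJ

/-- A cochain of degree `n` is given by its coefficients on words of length `n`. -/
noncomputable def cochainsEquiv (r s n : ℕ) :
    cochains r s n ≃ₗ[ℂ] (Idx r s → degree (Idx r s) n) where
  toFun φ i := ⟨coord φ.1 i, mem_cochains.1 φ.2 i⟩
  map_add' φ ψ := by ext; simp
  map_smul' c φ := by ext; simp
  invFun f := ⟨coord.symm fun i => (f i).1, mem_cochains.2 fun i => by simp⟩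
  left_inv φ := Subtype.ext (coord.symm_apply_apply _)
  right_inv f := by
    funext i
    exact Subtype.ext (congrFun (coord.apply_symm_apply fun i => (f i).1) i)

instance (n : ℕ) : Module.Finite ℂ (cochains r s n) :=
  Module.Finite.equiv (cochainsEquiv r s n).symm

theorem finrank_cochains (n : ℕ) : finrank ℂ (cochains r s n) = (r + s) ^ (n + 1) := by
  rw [(cochainsEquiv r s n).finrank_eq, finrank_pi_fintype]
  simp [finrank_degree, pow_succ']

variable (hs : 2 ≤ s)

theorem coboundary_eq_zero_iff {φ : Cochain r s} : coboundary (dNil r s hs) φ = 0 ↔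
    ((letters r s hs).del ((letters r s hs).sign (coord φ (letters r s hs).a)) = 0 ∧
      (letters r s hs).del ((letters r s hs).sign (coord φ (letters r s hs).b)) =
        (letters r s hs).adA ((letters r s hs).sign (coord φ (letters r s hs).a))) ∧
      ∀ x : (letters r s hs).Rest,
        (letters r s hs).del ((letters r s hs).sign (coord φ x.1)) = 0 := by
  rw [← map_eq_zero_iff _ coord.injective, funext_iff]
  simp only [coord_coboundary_dNil, Pi.zero_apply]
  rw [(letters r s hs).forall_letter, and_assoc]
  refine and_congr ?_ (and_congr ?_ (forall_congr' fun x => ?_))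
  · simp [(letters r s hs).a_ne_b, LetterData.sgn_a]
  · rw [if_pos rfl, LetterData.sgn_b, neg_one_smul, sub_neg_eq_add, neg_add_eq_zero, eq_comm]
  · simp [x.2.2, LetterData.sgn_ne_zero]

theorem coboundary_mem {n : ℕ} {φ : Cochain r s} (h : φ ∈ cochains r s n) :
    coboundary (dNil r s hs) φ ∈ cochains r s (n + 1) := by
  rw [mem_cochains] at h ⊢
  intro i
  rw [coord_coboundary_dNil]
  have hm : ∀ j, (letters r s hs).sign (coord φ j) ∈ degree (Idx r s) n :=
    fun j => LetterData.sign_mem _ (h j)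
  refine sub_mem ?_ (Submodule.smul_mem _ _ (LetterData.del_mem _ (hm i)))
  split_ifs
  exacts [neg_mem (LetterData.adA_mem _ (hm _)), zero_mem _]

theorem LetterData.del_adA {ι : Type*} [DecidableEq ι] (S : LetterData ι) (u : WordFun ι) :
    S.del (S.adA u) = -S.adA (S.del u) := by
  rw [adA_apply, adA_apply, map_sub, del_left, del_right]
  abel

theorem LetterData.sign_adA {ι : Type*} [DecidableEq ι] (S : LetterData ι) (u : WordFun ι) :
    S.sign (S.adA u) = -S.adA (S.sign u) := by
  rw [adA_apply, adA_apply, map_sub, sign_left, sign_right _ _ S.sgn_a]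
  abel

theorem coboundary_coboundary (φ : Cochain r s) :
    coboundary (dNil r s hs) (coboundary (dNil r s hs) φ) = 0 := by
  rw [coboundary_eq_zero_iff]
  have hab := (letters r s hs).a_ne_b
  refine ⟨⟨?_, ?_⟩, fun x => ?_⟩
  · simp [coord_coboundary_dNil, hab, LetterData.sign_del, LetterData.del_del]
  · simp [coord_coboundary_dNil, hab, LetterData.sign_del, LetterData.sign_adA,
      LetterData.del_del, LetterData.del_adA, LetterData.sgn_a, LetterData.sgn_b]
  · simp [coord_coboundary_dNil, x.2.2, LetterData.sign_del, LetterData.del_del]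

/-- The cocycles split into cycles for the letters other than `a`, `b` and cone cycles. -/
noncomputable def cocyclesEquiv (n : ℕ) : cocycles (dNil r s hs) n ≃ₗ[ℂ]
    ((letters r s hs).Rest → (letters r s hs).cyc n) × (letters r s hs).pairCyc n where
  toFun φ :=
    have h := (coboundary_eq_zero_iff hs).1 φ.2.2
    have hm := fun i => (letters r s hs).sign_mem (mem_cochains.1 φ.2.1 i)
    (fun x => ⟨(letters r s hs).sign (coord φ.1 x.1), hm x.1, h.2 x⟩,
      ⟨((letters r s hs).sign (coord φ.1 (letters r s hs).a),
        (letters r s hs).sign (coord φ.1 (letters r s hs).b)),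
        (LetterData.mem_pairCyc _).2 ⟨⟨hm _, hm _⟩, h.1⟩⟩)
  map_add' φ ψ := by
    refine Prod.ext (funext fun x => Subtype.ext ?_) (Subtype.ext (Prod.ext ?_ ?_)) <;> simp
  map_smul' c φ := by
    refine Prod.ext (funext fun x => Subtype.ext ?_) (Subtype.ext (Prod.ext ?_ ?_)) <;> simp
  invFun t :=
    have hp := (LetterData.mem_pairCyc _).1 t.2.2
    ⟨coord.symm ((letters r s hs).pick ((letters r s hs).sign t.2.1.1)
      ((letters r s hs).sign t.2.1.2) fun x => (letters r s hs).sign (t.1 x).1),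
      mem_cochains.2 ((letters r s hs).forall_letter.2
        ⟨by simpa using LetterData.sign_mem _ hp.1.1, by simpa using LetterData.sign_mem _ hp.1.2,
          fun x => by simpa using LetterData.sign_mem _ (t.1 x).2.1⟩),
      (coboundary_eq_zero_iff hs).2
        ⟨by simpa [LetterData.sign_sign] using hp.2,
          fun x => by simpa [LetterData.sign_sign] using (t.1 x).2.2⟩⟩
  left_inv φ := by
    refine Subtype.ext (coord.injective (funext ?_))
    rw [(letters r s hs).forall_letter]
    simp [LetterData.sign_sign]
  right_inv t := by
    refine Prod.ext (funext fun x => Subtype.ext ?_) (Subtype.ext (Prod.ext ?_ ?_)) <;>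
      simp [LetterData.sign_sign]

theorem isCodifferential_dNil : IsCodifferential (dNil r s hs) := by
  refine ⟨(parityPart_dNil hs 1).trans (if_pos rfl), ?_⟩
  -- As `[d, d]` is the coboundary of `d`, the cocycle criterion applies; the only nonzero
  -- coordinate of `d` is the word `aa` at `b`, and `del` kills it.
  change coboundary (dNil r s hs) (dNil r s hs) = 0
  have h0 : ∀ i, i ≠ (letters r s hs).b → coord (dNil r s hs) i = 0 := fun i hi => by
    funext J
    simp [coord_dNil, hi]
  have hb : coord (dNil r s hs) (letters r s hs).b =
      (letters r s hs).left ((letters r s hs).left one) := by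
    funext J
    rw [coord_dNil]
    rcases J with _ | ⟨i, _ | ⟨j, K⟩⟩
    · simp
    · rw [← slice_apply i ((letters r s hs).left _), LetterData.slice_left]
      split_ifs <;> simp_all
    · rw [← slice_apply i ((letters r s hs).left _), LetterData.slice_left]
      by_cases hi : i = (letters r s hs).a
      · rw [if_pos hi, ← slice_apply j ((letters r s hs).left _), LetterData.slice_left]
        by_cases hj : j = (letters r s hs).a
        · cases K <;> simp [hi, hj, one]
        · simp [hj]
      · simp [hi]
  rw [coboundary_eq_zero_iff, h0 _ (letters r s hs).a_ne_b, hb]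
  refine ⟨⟨by simp, ?_⟩, fun x => by rw [h0 _ x.2.2]; simp⟩
  rw [LetterData.sign_left, LetterData.sign_left, LetterData.sign_one]
  simp [LetterData.del_left]

theorem coboundaries_le (n : ℕ) :
    coboundaries (dNil r s hs) n ≤ cocycles (dNil r s hs) n := by
  cases n with
  | zero => exact bot_le
  | succ n =>
    rintro _ ⟨φ, hφ, rfl⟩
    exact ⟨coboundary_mem hs hφ, coboundary_coboundary hs φ⟩

instance (n : ℕ) : Module.Finite ℂ (cocycles (dNil r s hs) n) :=
  Module.Finite.equiv (cocyclesEquiv hs n).symm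

theorem finrank_cocycles (n : ℕ) : finrank ℂ (cocycles (dNil r s hs) n) =
    Fintype.card (letters r s hs).Rest * finrank ℂ ((letters r s hs).cyc n) +
      finrank ℂ ((letters r s hs).pairCyc n) := by
  rw [(cocyclesEquiv hs n).finrank_eq, finrank_prod, finrank_pi_fintype]
  simp

/-- Rank-nullity for the coboundary restricted to `C^n`. -/
theorem finrank_coboundaries_add (n : ℕ) : finrank ℂ (coboundaries (dNil r s hs) (n + 1)) +
    finrank ℂ (cocycles (dNil r s hs) n) = (r + s) ^ (n + 1) := by
  have h := LinearMap.finrank_range_add_finrank_ker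
    ((coboundary (dNil r s hs)).domRestrict (cochains r s n))
  rw [LinearMap.range_domRestrict, LinearMap.ker_domRestrict, finrank_cochains] at h
  rw [← h, cocycles, coboundaries]
  congr 1
  rw [← Submodule.finrank_map_subtype_eq, Submodule.map_comap_subtype]

theorem finrank_cohomology_add (n : ℕ) : finrank ℂ (Cohomology (dNil r s hs) n) +
    finrank ℂ (coboundaries (dNil r s hs) n) = finrank ℂ (cocycles (dNil r s hs) n) := by
  rw [← (Submodule.submoduleOfEquivOfLe (coboundaries_le hs n)).finrank_eq]
  exact Submodule.finrank_quotient_add_finrank _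

end NilpotentCohomology

theorem theorem2 (r s : ℕ) (hs : 2 ≤ s) :
    NilpotentCohomology.IsCodifferential (NilpotentCohomology.dNil r s hs) ∧
      ∀ n : ℕ,
        Module.Finite ℂ (NilpotentCohomology.Cohomology (NilpotentCohomology.dNil r s hs) n) ∧
        Module.finrank ℂ (NilpotentCohomology.Cohomology (NilpotentCohomology.dNil r s hs) n) =
          (r + s - 1) ^ (n + 1) + 1 := by
  refine ⟨NilpotentCohomology.isCodifferential_dNil hs, fun n => ⟨inferInstance, ?_⟩⟩
  have hcard := (NilpotentCohomology.letters r s hs).card_rest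
  set N := Fintype.card (NilpotentCohomology.letters r s hs).Rest with hN
  have hrs : r + s = N + 2 := by rw [← hcard]; simp
  have hq := NilpotentCohomology.finrank_cohomology_add (r := r) hs n
  have hz := NilpotentCohomology.finrank_cocycles (r := r) hs n
  rw [← hN] at hz
  rw [hrs, show N + 2 - 1 = N + 1 by omega]
  cases n with
  | zero =>
    have h0 : Module.finrank ℂ (NilpotentCohomology.coboundaries
      (NilpotentCohomology.dNil r s hs) 0) = 0 := finrank_bot _ _
    rw [NilpotentCohomology.LetterData.cyc_zero, NilpotentCohomology.WordFun.finrank_degree,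
      (NilpotentCohomology.LetterData.pairCycZeroEquiv _).finrank_eq, Module.finrank_prod,
      NilpotentCohomology.WordFun.finrank_degree] at hz
    rw [h0, hz] at hq
    simp at hq ⊢
    omega
  | succ n =>
    have hb := NilpotentCohomology.finrank_coboundaries_add (r := r) hs n
    have hz' := NilpotentCohomology.finrank_cocycles (r := r) hs n
    have h1 := (NilpotentCohomology.letters r s hs).finrank_cyc_add n
    have h2 := (NilpotentCohomology.letters r s hs).finrank_pairCyc_add n
    rw [← hN] at hz' h1 h2
    rw [hrs] at hb
    -- Only sums of cycle dimensions in consecutive degrees occur, so the two recurrences suffice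
    -- without closed forms.
    zify at hq hz hb hz' h1 h2 ⊢
    linear_combination hq + hz - hb + hz' + N * h1 + h2
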